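/- For real-valued locally integrable functions $p,q$ and a function $y=(y_1,y_2)^T$ with values in $\mathbb C^2$, put $$\ell y = B y' + \Omega y,\qquad B=\begin{pmatrix}0&1\\-1&0\end{pmatrix},\quad \Omega=\begin{pmatrix}p&q\\q&-p\end{pmatrix}.$$ For $\alpha\in(-\pi/2,\pi/2]$ let $L(p,q,\alpha)$ be the operator $y\mapsto\ell y$ in $L^2((0,\infty);\mathbb C^2)$ with domain $D_\alpha$, the set of all $y$ such that $y_1,y_2\in L^2(0,\infty)$ are absolutely continuous on each segment $[a,b]\subset(0,\infty)$, $\ell y\in L^2((0,\infty);\mathbb C^2)$, and $y_1(0)\cos\alpha+y_2(0)\sin\alpha=0$, where $y(0)=\lim_{x\to0+}y(x)$. A number $\lambda\in\mathbb C$ is an eigenvalue if $\ell y=\lambda y$ has a non-trivial solution $y\in D_\alpha$; such solutions are the eigenfunctions. Functions are compared on $(0,\infty)$. Let $H_n(x)=(-1)^ne^{x^2}\frac{d^n}{dx^n}e^{-x^2}$ and $\varphi_n(x)=(2^n n!\sqrt\pi)^{-1/2}e^{-x^2/2}H_n(x)$ for $n\ge 0$, let $U_0=(0,\varphi_0)^T$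 and $U_{\pm n}=(\pm\varphi_{n-1},\varphi_n)^T$ for $n\ge1$, and consider $p\equiv0$, $q(x)=x$. (a) The eigenvalues of $L(0,x,0)$ (boundary condition $y_1(0)=0$) are exactly the numbers $\lambda_k=2\sqrt{|k|}\,\mathrm{sign}(k)=\sqrt{2|2k|}\,\mathrm{sign}(2k)$, $k\in\mathbb Z$, which are strictly increasing in $k$. (b) For each $n\in\mathbb Z$, $\varphi_{2|n|}(0)\ne0$, and $U_{2n}$ and $$V_n=-\frac{U_{2n}}{\varphi_{2|n|}(0)}$$ are eigenfunctions of $L(0,x,0)$ for $\lambda_n$; the eigenfunctions for $\lambda_n$ are exactly the functions $cV_n$, $c\in\mathbb C\setminus\{0\}$. Moreover $V_n$ is the unique solution on $(0,\infty)$ of the Cauchy problem $\ell y=\lambda_n y$, $y(0)=(0,-1)^T$ (the case $\alpha=0$ of the initial condition $y(0)=(\sin\alpha,-\cos\alpha)^T$). (c) The norming constants $a_n=\int_0^\infty\left(|V_{n,1}(x)|^2+|V_{n,2}(x)|^2\right)dx$, $n\in\mathbb Z$, are finite, and $$a_0=\frac{\sqrt\pi}{2},\qquad a_{-n}=a_n=\frac1{|\varphi_{2n}(0)|^2}=\frac{4^n(n!)^2\sqrt\pi}{(2n)!},\quad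 n=1,2,\dots$$ (d) The eigenvalues of $L(0,x,\pi/2)$ (boundary condition $y_2(0)=0$) are exactly the numbers $\sqrt{2|2k+1|}\,\mathrm{sign}(2k+1)$, $k\in\mathbb Z$, which are strictly increasing in $k$; the eigenfunctions for the $k$-th of them are exactly the functions $cU_{2k+1}$, $c\in\mathbb C\setminus\{0\}$. -/

import Mathlib

open MeasureTheory Set Filter Topology

noncomputable section

namespace DiracLinear

/-- The canonical Dirac expression `ℓ y = B y' + Ω y`, where `B = (0 1; -1 0)` and
`Ω = (p q; q -p)`; the components `y₁, y₂` are `y · 0` and `y · 1`. -/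
def diracExpr (p q : ℝ → ℝ) (y : ℝ → Fin 2 → ℂ) (x : ℝ) : Fin 2 → ℂ :=
  ![deriv (fun t => y t 1) x + (p x : ℂ) * y x 0 + (q x : ℂ) * y x 1,
    -deriv (fun t => y t 0) x + (q x : ℂ) * y x 0 - (p x : ℂ) * y x 1]

/-- Both components are absolutely continuous on each segment `[a, b] ⊂ (0, ∞)`. -/
def IsLocallyAC (y : ℝ → Fin 2 → ℂ) : Prop :=
  ∀ k : Fin 2, ∀ a b : ℝ, 0 < a → a < b → AbsolutelyContinuousOnInterval (fun x => y x k) a b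

/-- Both components are square integrable on `(0, ∞)`. -/
def IsL2 (y : ℝ → Fin 2 → ℂ) : Prop :=
  ∀ k : Fin 2, MemLp (fun x => y x k) 2 (volume.restrict (Ioi (0 : ℝ)))

/-- The boundary value `y(0) = v`, understood as the limit of `y(x)` for `x → 0+`. A function is
only considered on `(0, ∞)`, so its values at the points `x ≤ 0` play no role. -/
def HasBoundaryValue (y : ℝ → Fin 2 → ℂ) (v : Fin 2 → ℂ) : Prop :=
  ∀ k : Fin 2, Tendsto (fun x => y x k) (𝓝[>] (0 : ℝ)) (𝓝 (v k))

/-- The domain of the operator `L(p, q, α)` in `L²((0, ∞); ℂ²)`. -/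
def diracDomain (p q : ℝ → ℝ) (α : ℝ) : Set (ℝ → Fin 2 → ℂ) :=
  {y | IsL2 y ∧ IsLocallyAC y ∧ IsL2 (diracExpr p q y) ∧
    ∃ v : Fin 2 → ℂ, HasBoundaryValue y v ∧
      v 0 * (Real.cos α : ℂ) + v 1 * (Real.sin α : ℂ) = 0}

/-- `ℓ y = lam y` almost everywhere on `(0, ∞)`. -/
def SolvesSystem (p q : ℝ → ℝ) (lam : ℂ) (y : ℝ → Fin 2 → ℂ) : Prop :=
  ∀ᵐ x ∂(volume.restrict (Ioi (0 : ℝ))), diracExpr p q y x = lam • y x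

/-- `y` is an eigenfunction of `L(p, q, α)` for `lam`: a solution of `ℓ y = lam y` from the domain
of the operator, which is non-trivial on `(0, ∞)`. -/
def IsEigenfunction (p q : ℝ → ℝ) (α : ℝ) (lam : ℂ) (y : ℝ → Fin 2 → ℂ) : Prop :=
  y ∈ diracDomain p q α ∧ SolvesSystem p q lam y ∧ ∃ x : ℝ, 0 < x ∧ y x ≠ 0

/-- `lam` is an eigenvalue of `L(p, q, α)`. -/
def IsEigenvalue (p q : ℝ → ℝ) (α : ℝ) (lam : ℂ) : Prop :=
  ∃ y : ℝ → Fin 2 → ℂ, IsEigenfunction p q α lam y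

/-- `y` solves on `(0, ∞)` the Cauchy problem `ℓ y = lam y`, `y(0) = (sin α, -cos α)`. -/
def IsCauchySolution (p q : ℝ → ℝ) (lam α : ℂ) (y : ℝ → Fin 2 → ℂ) : Prop :=
  IsLocallyAC y ∧ SolvesSystem p q lam y ∧
    HasBoundaryValue y ![Complex.sin α, -Complex.cos α]

/-- The Chebyshev-Hermite polynomial `H_n(x) = (-1)^n e^{x²} (d/dx)^n e^{-x²}`. -/
def hermiteH (n : ℕ) (x : ℝ) : ℝ :=
  (-1) ^ n * Real.exp (x ^ 2) * iteratedDeriv n (fun t : ℝ => Real.exp (-t ^ 2)) x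

/-- The orthonormal Chebyshev-Hermite function `φ_n`. -/
def hermitePhi (n : ℕ) (x : ℝ) : ℝ :=
  1 / Real.sqrt (2 ^ n * (n.factorial : ℝ) * Real.sqrt Real.pi) *
    Real.exp (-x ^ 2 / 2) * hermiteH n x

/-- `U_n = (φ_{n-1}, φ_n)`, `U_0 = (0, φ_0)` and `U_{-n} = (-φ_{n-1}, φ_n)` for `n ≥ 1`. -/
def vecU (n : ℤ) (x : ℝ) : Fin 2 → ℂ :=
  if 0 < n then ![(hermitePhi (n.natAbs - 1) x : ℂ), (hermitePhi n.natAbs x : ℂ)]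
  else if n = 0 then ![0, (hermitePhi 0 x : ℂ)]
  else ![-(hermitePhi (n.natAbs - 1) x : ℂ), (hermitePhi n.natAbs x : ℂ)]

/-- `V_n = -U_{2n} / φ_{2|n|}(0)`. -/
def vecV (n : ℤ) (x : ℝ) : Fin 2 → ℂ :=
  (-(1 / (hermitePhi (2 * n.natAbs) 0 : ℂ))) • vecU (2 * n) x

/-- `√(2|n|) sign n`. -/
def axisEigenvalue (n : ℤ) : ℝ := Real.sqrt (2 * |(n : ℝ)|) * (Int.sign n : ℝ)

/-- `2 √|k| sign k`. -/
def halfAxisEigenvalue (k : ℤ) : ℝ := 2 * Real.sqrt |(k : ℝ)| * (Int.sign k : ℝ)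

/-- The norming constant `a_n`, the squared `L²(0, ∞)` norm of `V_n`. -/
def normingConstant (n : ℤ) : ℝ :=
  ∫ x in Ioi (0 : ℝ), (‖vecV n x 0‖ ^ 2 + ‖vecV n x 1‖ ^ 2)

/-- The potential of `L(0, x, α)`: `p = 0` and `q(x) = x`. -/
def pLin : ℝ → ℝ := fun _ => 0

/-- See `pLin`. -/
def qLin : ℝ → ℝ := fun x => x

end DiracLinear

end

/-! For `p = 0`, `q(x) = x` the equation is the first-order system y₁' = x y₁ - λ y₂, y₂' = λ y₁ - x
y₂. The creation and annihilation relations of the Hermite functions say that U_n solves it at λ =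
√(2|n|) sign n. Parity decides the boundary condition: φ_m(0) vanishes for odd m and not for even m,
so U_{2k} fits α = 0 and U_{2k+1} fits α = π/2.

That nothing else occurs is a ladder argument, valid for complex λ from the start. The pair f = y₂,
g = λ y₁ satisfies f' + x f = g, -g' + x g = ν f with ν = λ². Passing to (g, g' + x g) lowers ν by
2, keeps square integrability (`memLp_mul_snd`) and keeps the condition f(0) g(0) = 0. Once Re ν <
0, the identity (Re (f̄ g))' = |g|² - Re ν |f|² forces f = 0, since Re (f̄ g) vanishes at both ends.
Tracing back, λ² is an even natural number (`eq_zero_or_exists_nat`).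

Eigenvalues are simple because the Wronskian of two square integrable solutions is both constant and
integrable on a half-line, hence zero. The norming constants reduce to ∫₀^∞ φ_n² = 1/2 and the
explicit value H_{2n}(0). -/

namespace DiracLinear

/-! ### Regularity: from almost everywhere equations to classical ones. -/

/-- A continuously differentiable function on `(0, ∞)` is absolutely continuous on segments. -/
theorem absolutelyContinuousOnInterval_of_hasDerivAt {f f' : ℝ → ℂ}
    (hf : ∀ x, 0 < x → HasDerivAt f (f' x) x) (hf' : ContinuousOn f' (Ioi 0)) {a b : ℝ}
    (ha : 0 < a) (hab : a < b) : AbsolutelyContinuousOnInterval f a b := by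
  have h : ContDiffOn ℝ 1 f (Ioi 0) := by
    rw [show (1 : WithTop ℕ∞) = 0 + 1 by simp, contDiffOn_succ_iff_deriv_of_isOpen isOpen_Ioi, contDiffOn_zero]
    exact ⟨fun x hx => (hf x hx).differentiableAt.differentiableWithinAt, by simp,
      hf'.congr fun x hx => (hf x hx).deriv⟩
  refine (h.mono ?_).absolutelyContinuousOnInterval
  rw [uIcc_of_le hab.le]
  exact fun x hx => ha.trans_le hx.1

/-- A locally absolutely continuous function whose derivative agrees almost everywhere with a
continuous function is continuously differentiable. -/
theorem hasDerivAt_of_ae_deriv_eq {f F : ℝ → ℂ}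
    (hf : ∀ a b : ℝ, 0 < a → a < b → AbsolutelyContinuousOnInterval f a b)
    (hF : ContinuousOn F (Ioi 0))
    (h : ∀ᵐ x ∂(volume.restrict (Ioi (0 : ℝ))), deriv f x = F x) {x : ℝ} (hx : 0 < x) :
    HasDerivAt f (F x) x := by
  -- The primitive of `F`, based at the arbitrary point 1. Near `x`, `f` minus it is absolutely
  -- continuous with derivative zero almost everywhere, hence constant.
  have hP : ∀ t, 0 < t → HasDerivAt (fun t => ∫ s in (1 : ℝ)..t, F s) (F t) t := fun t ht => by
    have hsub : uIcc 1 t ⊆ Ioi (0 : ℝ) := fun s hs =>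
      (lt_min one_pos ht).trans_le hs.1
    exact intervalIntegral.integral_hasDerivAt_right ((hF.mono hsub).intervalIntegrable)
      (hF.stronglyMeasurableAtFilter isOpen_Ioi t ht) (hF.continuousAt (Ioi_mem_nhds ht))
  have hac := (hf (x / 2) (x + 1) (by positivity) (by linarith))
  have hsub : uIcc (x / 2) (x + 1) ⊆ Ioi (0 : ℝ) := fun s hs => by
    rw [uIcc_of_le (by linarith)] at hs
    exact (half_pos hx).trans_le hs.1
  rw [ae_restrict_iff' measurableSet_Ioi] at h
  obtain ⟨C, hC⟩ := (hac.sub (absolutelyContinuousOnInterval_of_hasDerivAt hP hF (half_pos hx)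
    (by linarith : x / 2 < x + 1))).const_of_ae_hasDerivAt_zero (by
      filter_upwards [h, hac.boundedVariationOn.ae_differentiableAt_of_mem_uIcc] with t ht1 ht2 ht
      have h1 := (ht2 ht).hasDerivAt
      rw [ht1 (hsub ht)] at h1
      simpa using h1.sub (hP t (hsub ht)))
  have hev : f =ᶠ[𝓝 x] fun t => (∫ s in (1 : ℝ)..t, F s) + C := by
    filter_upwards [Icc_mem_nhds (by linarith : x / 2 < x) (by linarith : x < x + 1)] with t ht
    rw [← uIcc_of_le (by linarith)] at ht
    have := hC t ht
    simp only [Pi.sub_apply] at this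
    rw [← this]; ring
  exact ((hP x hx).add_const C).congr_of_eventuallyEq hev

/-- Everywhere differentiable solutions of `ℓ y = lam y` on `(0, ∞)` for `p = 0`, `q(x) = x`. -/
def IsClassicalSolution (lam : ℂ) (y : ℝ → Fin 2 → ℂ) : Prop :=
  (∀ x, 0 < x → HasDerivAt (fun t => y t 0) (x * y x 0 - lam * y x 1) x) ∧
    ∀ x, 0 < x → HasDerivAt (fun t => y t 1) (lam * y x 0 - x * y x 1) x

theorem isClassicalSolution_of_solvesSystem {lam : ℂ} {y : ℝ → Fin 2 → ℂ} (hac : IsLocallyAC y)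
    (hs : SolvesSystem pLin qLin lam y) : IsClassicalSolution lam y := by
  have hc : ∀ k, ContinuousOn (fun x => y x k) (Ioi 0) := fun k x hx => by
    have hx : 0 < x := hx
    refine ((hac k (x / 2) (x + 1) (by positivity) (by linarith)).continuousOn.continuousAt
      ?_).continuousWithinAt
    rw [uIcc_of_le (by linarith)]
    exact Icc_mem_nhds (by linarith) (by linarith)
  have hi : ContinuousOn (fun x : ℝ => (x : ℂ)) (Ioi 0) := Complex.continuous_ofReal.continuousOn
  refine ⟨fun x hx => hasDerivAt_of_ae_deriv_eq (hac 0)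
      (F := fun x => x * y x 0 - lam * y x 1)
      ((hi.mul (hc 0)).sub (continuousOn_const.mul (hc 1))) ?_ hx,
    fun x hx => hasDerivAt_of_ae_deriv_eq (hac 1)
      (F := fun x => lam * y x 0 - x * y x 1)
      ((continuousOn_const.mul (hc 0)).sub (hi.mul (hc 1))) ?_ hx⟩
  · filter_upwards [hs] with x hx
    have := congrFun hx 1
    simp [diracExpr, pLin, qLin] at this
    linear_combination -this
  · filter_upwards [hs] with x hx
    have := congrFun hx 0
    simp [diracExpr, pLin, qLin] at this
    linear_combination this

/-! ### Classical solutions: uniqueness and the Wronskian. -/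

namespace IsClassicalSolution

variable {lam : ℂ} {y : ℝ → Fin 2 → ℂ}

theorem continuousOn (h : IsClassicalSolution lam y) (k : Fin 2) :
    ContinuousOn (fun x => y x k) (Ioi 0) := by
  fin_cases k
  · exact fun x hx => (h.1 x hx).continuousAt.continuousWithinAt
  · exact fun x hx => (h.2 x hx).continuousAt.continuousWithinAt

theorem isLocallyAC (h : IsClassicalSolution lam y) : IsLocallyAC y := by
  have hi : ContinuousOn (fun x : ℝ => (x : ℂ)) (Ioi 0) := Complex.continuous_ofReal.continuousOn
  intro k a b ha hab
  fin_cases k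
  · exact absolutelyContinuousOnInterval_of_hasDerivAt h.1
      ((hi.mul (h.continuousOn 0)).sub (continuousOn_const.mul (h.continuousOn 1))) ha hab
  · exact absolutelyContinuousOnInterval_of_hasDerivAt h.2
      ((continuousOn_const.mul (h.continuousOn 0)).sub (hi.mul (h.continuousOn 1))) ha hab

theorem diracExpr_eq (h : IsClassicalSolution lam y) {x : ℝ} (hx : 0 < x) :
    diracExpr pLin qLin y x = lam • y x := by
  ext k
  fin_cases k
  · simp [diracExpr, pLin, qLin, (h.2 x hx).deriv]
  · simp [diracExpr, pLin, qLin, (h.1 x hx).deriv]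

theorem solvesSystem (h : IsClassicalSolution lam y) : SolvesSystem pLin qLin lam y :=
  (ae_restrict_iff' measurableSet_Ioi).2 (.of_forall fun _ hx => h.diracExpr_eq hx)

theorem const_smul (h : IsClassicalSolution lam y) (c : ℂ) :
    IsClassicalSolution lam (fun x => c • y x) := by
  refine ⟨fun x hx => ?_, fun x hx => ?_⟩
  · convert! (h.1 x hx).const_mul c using 1
    simp; ring
  · convert! (h.2 x hx).const_mul c using 1
    simp; ring

theorem sub {z : ℝ → Fin 2 → ℂ} (h : IsClassicalSolution lam y) (hz : IsClassicalSolution lam z) :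
    IsClassicalSolution lam (fun x => y x - z x) := by
  refine ⟨fun x hx => ?_, fun x hx => ?_⟩
  · convert! (h.1 x hx).sub (hz.1 x hx) using 1
    simp; ring
  · convert! (h.2 x hx).sub (hz.2 x hx) using 1
    simp; ring

theorem congr {z : ℝ → Fin 2 → ℂ} (h : IsClassicalSolution lam y)
    (hyz : ∀ x, 0 < x → z x = y x) : IsClassicalSolution lam z := by
  have hev : ∀ k x, 0 < x → (fun t => z t k) =ᶠ[𝓝 x] fun t => y t k := fun k x hx => by
    filter_upwards [Ioi_mem_nhds hx] with t ht
    rw [hyz t ht]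
  refine ⟨fun x hx => ?_, fun x hx => ?_⟩
  · rw [hyz x hx]; exact (h.1 x hx).congr_of_eventuallyEq (hev 0 x hx)
  · rw [hyz x hx]; exact (h.2 x hx).congr_of_eventuallyEq (hev 1 x hx)

/-- For real `lam`, a solution with zero boundary value vanishes. -/
theorem eq_zero {lam : ℝ} (h : IsClassicalSolution lam y) (h0 : HasBoundaryValue y 0) {x : ℝ}
    (hx : 0 < x) : y x = 0 := by
  -- For real `lam` the coupling terms cancel: (|y₁|² + |y₂|²)' = 2x (|y₁|² - |y₂|²). The weight
  -- e^{-x²} removes the growing term and leaves a nonpositive derivative, so `E` decreases from its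
  -- limit 0.
  set E : ℝ → ℝ := fun x => Real.exp (-x ^ 2) * (‖y x 0‖ ^ 2 + ‖y x 1‖ ^ 2) with hE
  have hd : ∀ t, 0 < t → HasDerivAt E (Real.exp (-t ^ 2) * (-4 * t * ‖y t 1‖ ^ 2)) t := by
    intro t ht
    have e1 : HasDerivAt (fun t : ℝ => Real.exp (-t ^ 2)) (Real.exp (-t ^ 2) * (-(2 * t))) t := by
      simpa using ((hasDerivAt_pow 2 t).neg).exp
    convert! e1.mul ((h.1 t ht).norm_sq.add (h.2 t ht).norm_sq) using 1
    simp only [Complex.inner, ← Complex.normSq_eq_norm_sq, Complex.normSq_apply]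
    simp
    ring
  have hanti : AntitoneOn E (Ioi 0) := by
    refine antitoneOn_of_hasDerivWithinAt_nonpos (convex_Ioi 0)
      (fun t ht => (hd t ht).continuousAt.continuousWithinAt)
      (fun t ht => (hd t (interior_subset ht)).hasDerivWithinAt) fun t ht => ?_
    have ht : 0 < t := interior_subset ht
    have : 0 ≤ t * ‖y t 1‖ ^ 2 := by positivity
    nlinarith [Real.exp_pos (-t ^ 2)]
  have hlim : Tendsto E (𝓝[>] 0) (𝓝 0) := by
    have e : Tendsto (fun t : ℝ => Real.exp (-t ^ 2)) (𝓝[>] 0) (𝓝 (Real.exp (-0 ^ 2))) :=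
      ((by fun_prop : Continuous fun t : ℝ => Real.exp (-t ^ 2)).tendsto 0).mono_left
        nhdsWithin_le_nhds
    simpa using e.mul (((h0 0).norm.pow 2).add ((h0 1).norm.pow 2))
  have hle : E x ≤ 0 := by
    refine ge_of_tendsto hlim ?_
    filter_upwards [Ioo_mem_nhdsGT hx] with t ht
    exact hanti ht.1 hx ht.2.le
  have : ‖y x 0‖ ^ 2 + ‖y x 1‖ ^ 2 ≤ 0 := by
    by_contra! hc
    exact absurd hle (not_le.2 (mul_pos (Real.exp_pos _) hc))
  ext k
  fin_cases k
  · simpa using (by nlinarith [sq_nonneg ‖y x 0‖, sq_nonneg ‖y x 1‖] : ‖y x 0‖ ^ 2 = 0)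
  · simpa using (by nlinarith [sq_nonneg ‖y x 0‖, sq_nonneg ‖y x 1‖] : ‖y x 1‖ ^ 2 = 0)

/-- Two square integrable solutions for the same `lam` are linearly dependent. -/
theorem wronskian_eq_zero {z : ℝ → Fin 2 → ℂ} (h : IsClassicalSolution lam y)
    (hz : IsClassicalSolution lam z) (hy2 : IsL2 y) (hz2 : IsL2 z) {x : ℝ} (hx : 0 < x) :
    y x 0 * z x 1 - y x 1 * z x 0 = 0 := by
  set W : ℝ → ℂ := fun x => y x 0 * z x 1 - y x 1 * z x 0 with hW
  have hd : ∀ t ∈ Ioi (0 : ℝ), HasDerivAt W 0 t := fun t ht => by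
    convert! ((h.1 t ht).mul (hz.2 t ht)).sub ((h.2 t ht).mul (hz.1 t ht)) using 1
    ring
  -- Products of square integrable functions are integrable, and a constant integrable on a
  -- half-line is zero.
  have hint : IntegrableOn W (Ioi 0) :=
    ((hy2 0).integrable_mul (hz2 1)).sub ((hy2 1).integrable_mul (hz2 0))
  have hlim := tendsto_zero_of_hasDerivAt_of_integrableOn_Ioi hd integrableOn_zero hint
  have hconst : ∀ t ∈ Ioi (0 : ℝ), W t = W x := fun t ht =>
    (convex_Ioi (0 : ℝ)).is_const_of_fderivWithin_eq_zero (𝕜 := ℝ) (f := W)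
      (fun s hs => (hd s hs).differentiableAt.differentiableWithinAt)
      (fun s hs => by
        have := (hd s hs).hasFDerivAt.hasFDerivWithinAt.fderivWithin (isOpen_Ioi.uniqueDiffWithinAt hs)
        rw [this]; ext; simp) ht hx
  refine tendsto_nhds_unique (tendsto_const_nhds.congr' ?_) hlim
  filter_upwards [Ioi_mem_atTop 0] with t ht
  exact (hconst t ht).symm

end IsClassicalSolution

/-! ### Ladder pairs: quantization of ν = λ². -/

/-- Square integrable solutions of `f' + x f = g`, `-g' + x g = ν f` on `(0, ∞)`. -/
structure IsLadderPair (ν : ℂ) (f g : ℝ → ℂ) : Prop where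
  deriv_fst : ∀ x, 0 < x → HasDerivAt f (g x - x * f x) x
  deriv_snd : ∀ x, 0 < x → HasDerivAt g (x * g x - ν * f x) x
  memLp_fst : MemLp f 2 (volume.restrict (Ioi 0))
  memLp_snd : MemLp g 2 (volume.restrict (Ioi 0))

namespace IsLadderPair

variable {ν : ℂ} {f g : ℝ → ℂ}

theorem continuousOn_snd (h : IsLadderPair ν f g) : ContinuousOn g (Ioi 0) :=
  fun x hx => (h.deriv_snd x hx).continuousAt.continuousWithinAt

theorem continuousOn_fst (h : IsLadderPair ν f g) : ContinuousOn f (Ioi 0) :=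
  fun x hx => (h.deriv_fst x hx).continuousAt.continuousWithinAt

theorem integrableOn_sq_fst (h : IsLadderPair ν f g) :
    IntegrableOn (fun x => ‖f x‖ ^ 2) (Ioi 0) :=
  (memLp_two_iff_integrable_sq_norm h.memLp_fst.1).1 h.memLp_fst

theorem integrableOn_sq_snd (h : IsLadderPair ν f g) :
    IntegrableOn (fun x => ‖g x‖ ^ 2) (Ioi 0) :=
  (memLp_two_iff_integrable_sq_norm h.memLp_snd.1).1 h.memLp_snd

/-- Otherwise ‖g‖² would eventually exceed 1/x, which is not integrable. This supplies arbitrarily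
large endpoints with a bounded boundary term. -/
theorem frequently_mul_sq_le (h : IsLadderPair ν f g) :
    ∃ᶠ x : ℝ in atTop, x * ‖g x‖ ^ 2 ≤ 1 := by
  intro hev
  obtain ⟨R, hR⟩ := eventually_atTop.1 hev
  refine not_integrableOn_Ioi_inv (a := max R 1) ?_
  refine Integrable.mono' (g := fun x => ‖g x‖ ^ 2)
    (h.integrableOn_sq_snd.mono_set (Ioi_subset_Ioi (by positivity))) (by fun_prop) ?_
  refine (ae_restrict_iff' measurableSet_Ioi).2 (.of_forall fun x hx => ?_)
  have hx1 : R ≤ x := (le_max_left _ _).trans hx.le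
  have hx2 : 0 < x := one_pos.trans_le ((le_max_right _ _).trans hx.le)
  have := not_le.1 (hR x hx1)
  rw [Real.norm_of_nonneg (by positivity), inv_le_iff_one_le_mul₀' hx2]
  exact this.le

/-- Integrate (x |g|²)' = |g|² + 2x² |g|² - 2x Re⟨g, ν f⟩ and absorb the cross term by 2x |g| |ν f|
≤ x² |g|² + |ν|² |f|². -/
theorem intervalIntegral_sq_mul_sq_le (h : IsLadderPair ν f g) {R : ℝ} (hR : 1 ≤ R) :
    ∫ x in (1 : ℝ)..R, ‖x * g x‖ ^ 2 ≤
      R * ‖g R‖ ^ 2 + ‖ν‖ ^ 2 * ∫ x in Ioi (0 : ℝ), ‖f x‖ ^ 2 := by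
  have hsub : uIcc 1 R ⊆ Ioi (0 : ℝ) := fun s hs => by
    rw [uIcc_of_le hR] at hs; exact one_pos.trans_le hs.1
  have hf := h.continuousOn_fst.mono hsub
  have hg := h.continuousOn_snd.mono hsub
  set u' : ℝ → ℝ := fun x =>
    1 * ‖g x‖ ^ 2 + x * (2 * inner ℝ (g x) (x * g x - ν * f x)) with hu'
  have hi : ContinuousOn (fun x : ℝ => (x : ℂ)) (uIcc 1 R) :=
    Complex.continuous_ofReal.continuousOn
  have hu'c : ContinuousOn u' (uIcc 1 R) :=
    (continuousOn_const.mul (hg.norm.pow 2)).add (continuousOn_id.mul (continuousOn_const.mul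
      (hg.inner ((hi.mul hg).sub (continuousOn_const.mul hf)))))
  have hftc : ∫ x in (1 : ℝ)..R, u' x = R * ‖g R‖ ^ 2 - 1 * ‖g 1‖ ^ 2 :=
    intervalIntegral.integral_eq_sub_of_hasDerivAt (f := fun x => x * ‖g x‖ ^ 2)
      (fun x hx => (hasDerivAt_id x).mul (h.deriv_snd x (hsub hx)).norm_sq) hu'c.intervalIntegrable
  have hfc : ContinuousOn (fun x => ‖ν‖ ^ 2 * ‖f x‖ ^ 2) (uIcc 1 R) :=
    continuousOn_const.mul (hf.norm.pow 2)
  have hmono : ∫ x in (1 : ℝ)..R, ‖x * g x‖ ^ 2 ≤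
      ∫ x in (1 : ℝ)..R, (u' x + ‖ν‖ ^ 2 * ‖f x‖ ^ 2) := by
    refine intervalIntegral.integral_mono_on hR ((hi.mul hg).norm.pow 2).intervalIntegrable
      (hu'c.add hfc).intervalIntegrable fun x hx => ?_
    have hx0 : 0 ≤ x := zero_le_one.trans hx.1
    have h1 : inner ℝ (g x) (x * g x - ν * f x) = x * ‖g x‖ ^ 2 - inner ℝ (g x) (ν * f x) := by
      rw [inner_sub_right, ← Complex.real_smul, real_inner_smul_right, real_inner_self_eq_norm_sq]
    have h2 := real_inner_le_norm (g x) (ν * f x)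
    rw [norm_mul] at h2
    simp only [hu', h1, norm_mul, Complex.norm_real, Real.norm_of_nonneg hx0]
    nlinarith [sq_nonneg (x * ‖g x‖ - ‖ν‖ * ‖f x‖), mul_le_mul_of_nonneg_left h2 hx0,
      sq_nonneg ‖g x‖]
  rw [intervalIntegral.integral_add hu'c.intervalIntegrable hfc.intervalIntegrable, hftc,
    intervalIntegral.integral_const_mul] at hmono
  have hle : ∫ x in (1 : ℝ)..R, ‖f x‖ ^ 2 ≤ ∫ x in Ioi (0 : ℝ), ‖f x‖ ^ 2 := by
    rw [intervalIntegral.integral_of_le hR]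
    refine setIntegral_mono_set h.integrableOn_sq_fst (.of_forall fun x => by positivity)
      (LE.le.eventuallyLE ?_)
    exact fun x hx => one_pos.trans hx.1
  nlinarith [sq_nonneg ‖g 1‖, mul_le_mul_of_nonneg_left hle (sq_nonneg ‖ν‖)]

/-- This weighted bound is what keeps the lowered pair square integrable. -/
theorem memLp_mul_snd (h : IsLadderPair ν f g) :
    MemLp (fun x : ℝ => x * g x) 2 (volume.restrict (Ioi 0)) := by
  have hi : ContinuousOn (fun x : ℝ => (x : ℂ)) (Ioi 0) := Complex.continuous_ofReal.continuousOn
  have hc : ContinuousOn (fun x : ℝ => x * g x) (Ioi 0) := hi.mul h.continuousOn_snd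
  rw [memLp_two_iff_integrable_sq_norm (hc.aestronglyMeasurable measurableSet_Ioi)]
  change IntegrableOn (fun x : ℝ => ‖x * g x‖ ^ 2) (Ioi 0)
  rw [← Ioc_union_Ioi_eq_Ioi zero_le_one]
  refine IntegrableOn.union ?_ ?_
  · refine Integrable.mono' (g := fun x => ‖g x‖ ^ 2)
      (h.integrableOn_sq_snd.mono_set Ioc_subset_Ioi_self)
      (((hc.mono Ioc_subset_Ioi_self).norm.pow 2).aestronglyMeasurable measurableSet_Ioc) ?_
    refine (ae_restrict_iff' measurableSet_Ioc).2 (.of_forall fun x hx => ?_)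
    rw [norm_pow, norm_norm, norm_mul, Complex.norm_real, Real.norm_of_nonneg hx.1.le]
    exact pow_le_pow_left₀ (mul_nonneg hx.1.le (norm_nonneg (g x)))
      (mul_le_of_le_one_left (norm_nonneg (g x)) hx.2) 2
  -- Along this sequence the boundary term b‖g(b)‖² is at most 1, so the integrals over (1, b n) are
  -- uniformly bounded.
  · obtain ⟨b, hb, hb1⟩ := exists_seq_forall_of_frequently
      (h.frequently_mul_sq_le.and_eventually (eventually_ge_atTop 1))
    refine integrableOn_Ioi_of_intervalIntegral_norm_bounded
      (1 + ‖ν‖ ^ 2 * ∫ x in Ioi (0 : ℝ), ‖f x‖ ^ 2) 1 (b := b) (fun n => ?_) hb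
      (.of_forall fun n => ?_)
    · have : ContinuousOn (fun x : ℝ => ‖x * g x‖ ^ 2) (Icc 1 (b n)) :=
        (hc.mono fun x hx => one_pos.trans_le hx.1).norm.pow 2
      exact this.integrableOn_Icc.mono_set Ioc_subset_Icc_self
    · simp only [norm_pow, norm_norm]
      exact (h.intervalIntegral_sq_mul_sq_le (hb1 n).2).trans (by linarith [(hb1 n).1])

/-- Applying the annihilation operator lowers the parameter by two. -/
theorem lower (h : IsLadderPair ν f g) :
    IsLadderPair (ν - 2) g (fun x => 2 * x * g x - ν * f x) where
  deriv_fst x hx := by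
    convert! h.deriv_snd x hx using 1
    ring
  deriv_snd x hx := by
    convert! (((hasDerivAt_id x).ofReal_comp.const_mul 2).mul (h.deriv_snd x hx)).sub
      ((h.deriv_fst x hx).const_mul ν) using 1
    simp
    ring
  memLp_fst := h.memLp_snd
  memLp_snd := by
    convert! (h.memLp_mul_snd.const_mul 2).sub (h.memLp_fst.const_mul ν) using 1
    ext x
    simp [mul_assoc]

/-- For `re ν ≤ 0` the energy density vanishes, under a selfadjoint boundary condition at `0`. -/
theorem energy_density_eq_zero (h : IsLadderPair ν f g) (hν : ν.re ≤ 0) {a b : ℂ}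
    (ha : Tendsto f (𝓝[>] 0) (𝓝 a)) (hb : Tendsto g (𝓝[>] 0) (𝓝 b)) (hab : a * b = 0) :
    ∀ x, 0 < x → ‖g x‖ ^ 2 - ν.re * ‖f x‖ ^ 2 = 0 := by
  set w : ℝ → ℝ := fun x => inner ℝ (f x) (g x) with hw
  set w' : ℝ → ℝ := fun x => ‖g x‖ ^ 2 - ν.re * ‖f x‖ ^ 2 with hw'
  have hd : ∀ x ∈ Ioi (0 : ℝ), HasDerivAt w (w' x) x := fun x hx => by
    convert! (h.deriv_fst x hx).inner ℝ (h.deriv_snd x hx) using 1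
    simp only [hw', Complex.inner, ← Complex.normSq_eq_norm_sq, Complex.normSq_apply]
    simp
    ring
  have hw'c : ContinuousOn w' (Ioi 0) :=
    (h.continuousOn_snd.norm.pow 2).sub (continuousOn_const.mul (h.continuousOn_fst.norm.pow 2))
  have hw'i : IntegrableOn w' (Ioi 0) :=
    h.integrableOn_sq_snd.sub (h.integrableOn_sq_fst.const_mul _)
  have hwi : IntegrableOn w (Ioi 0) := by
    refine Integrable.mono' (g := fun x => ‖f x‖ ^ 2 + ‖g x‖ ^ 2)
      (Integrable.add h.integrableOn_sq_fst h.integrableOn_sq_snd)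
      ((h.continuousOn_fst.inner h.continuousOn_snd).aestronglyMeasurable measurableSet_Ioi)
      (.of_forall fun x => ?_)
    have := norm_inner_le_norm (𝕜 := ℝ) (f x) (g x)
    nlinarith [sq_nonneg (‖f x‖ - ‖g x‖), sq_nonneg ‖f x‖, sq_nonneg ‖g x‖]
  -- `w` is monotone when Re ν ≤ 0. It tends to 0 at infinity by integrability, and at 0 by the
  -- boundary condition, so it vanishes identically, and so does `w'`.
  have hlim := tendsto_zero_of_hasDerivAt_of_integrableOn_Ioi hd hw'i hwi
  have hlim0 : Tendsto w (𝓝[>] 0) (𝓝 0) := by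
    have := ha.inner (𝕜 := ℝ) hb
    rcases mul_eq_zero.1 hab with rfl | rfl <;> simpa only [inner_zero_left, inner_zero_right] using this
  have hmono : MonotoneOn w (Ioi 0) := by
    refine monotoneOn_of_hasDerivWithinAt_nonneg (convex_Ioi 0)
      (fun t ht => (hd t ht).continuousAt.continuousWithinAt)
      (fun t ht => (hd t (interior_subset ht)).hasDerivWithinAt) fun t ht => ?_
    have : 0 ≤ -ν.re * ‖f t‖ ^ 2 := mul_nonneg (by linarith) (sq_nonneg _)
    simp only [hw']
    nlinarith [sq_nonneg ‖g t‖]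
  have hw0 : ∀ x, 0 < x → w x = 0 := fun x hx => by
    refine le_antisymm (ge_of_tendsto hlim ?_) (le_of_tendsto hlim0 ?_)
    · filter_upwards [Ici_mem_atTop x] with t ht
      exact hmono hx (hx.trans_le ht) ht
    · filter_upwards [Ioo_mem_nhdsGT hx] with t ht
      exact hmono ht.1 hx ht.2.le
  intro x hx
  refine (hd x hx).unique ((hasDerivAt_const x (0 : ℝ)).congr_of_eventuallyEq ?_)
  filter_upwards [Ioi_mem_nhds hx] with t ht using hw0 t ht

/-- Each lowering step decreases Re ν by 2, so induction on `m` ends at Re ν < 0, where the energy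
identity leaves only f = 0. -/
theorem eq_zero_or_exists_nat_aux (m : ℕ) : ∀ {ν : ℂ} {f g : ℝ → ℂ}, IsLadderPair ν f g →
    ν.re < 2 * m → ∀ {a b : ℂ}, Tendsto f (𝓝[>] 0) (𝓝 a) → Tendsto g (𝓝[>] 0) (𝓝 b) →
    a * b = 0 → (∀ x, 0 < x → f x = 0) ∨ ∃ n : ℕ, ν = 2 * n := by
  induction m with
  | zero =>
    intro ν f g h hν a b ha hb hab
    left
    intro x hx
    have hν : ν.re < 0 := by simpa using hν
    have := h.energy_density_eq_zero hν.le ha hb hab x hx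
    have h2 : 0 ≤ -ν.re * ‖f x‖ ^ 2 := mul_nonneg (by linarith) (sq_nonneg _)
    have h3 : -ν.re * ‖f x‖ ^ 2 = 0 := by nlinarith [sq_nonneg ‖g x‖]
    simpa [hν.ne] using h3
  | succ m ih =>
    intro ν f g h hν a b ha hb hab
    have hi : Tendsto (fun x : ℝ => (x : ℂ)) (𝓝[>] 0) (𝓝 0) :=
      (Complex.continuous_ofReal.tendsto' 0 0 (by simp)).mono_left nhdsWithin_le_nhds
    have hlim : Tendsto (fun x : ℝ => 2 * x * g x - ν * f x) (𝓝[>] 0) (𝓝 (-ν * a)) := by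
      simpa using ((hi.const_mul 2).mul hb).sub (ha.const_mul ν)
    -- The lowered pair has limits b and -ν a at 0, with product -ν (a b) = 0, so the boundary
    -- condition survives.
    rcases ih h.lower (by push_cast at hν; simp; linarith) hb hlim
      (by linear_combination -ν * hab) with h0 | ⟨n, hn⟩
    -- Here the lowered pair is trivial, i.e. g = 0. Then g' = x g - ν f gives f = 0, unless ν = 0,
    -- the bottom of the ladder.
    · by_cases hν0 : ν = 0
      · exact .inr ⟨0, by simpa using hν0⟩
      · left
        intro x hx
        have h1 := (h.deriv_snd x hx).unique ((hasDerivAt_const x (0 : ℂ)).congr_of_eventuallyEq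
          (by filter_upwards [Ioi_mem_nhds hx] with t ht using h0 t ht))
        simpa [h0 x hx, hν0] using h1
    · exact .inr ⟨n + 1, by push_cast; linear_combination hn⟩

/-- A nontrivial ladder pair with a selfadjoint boundary condition has parameter `2 n`. -/
theorem eq_zero_or_exists_nat (h : IsLadderPair ν f g) {a b : ℂ}
    (ha : Tendsto f (𝓝[>] 0) (𝓝 a)) (hb : Tendsto g (𝓝[>] 0) (𝓝 b)) (hab : a * b = 0) :
    (∀ x, 0 < x → f x = 0) ∨ ∃ n : ℕ, ν = 2 * n := by
  obtain ⟨m, hm⟩ := exists_nat_gt (ν.re / 2)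
  exact eq_zero_or_exists_nat_aux m h (by linarith) ha hb hab

end IsLadderPair

/-! ### Hermite polynomials and Hermite functions. -/

theorem hasDerivAt_iteratedDeriv_exp_neg_sq (n : ℕ) (x : ℝ) :
    HasDerivAt (iteratedDeriv n fun t : ℝ => Real.exp (-t ^ 2))
      (iteratedDeriv (n + 1) (fun t : ℝ => Real.exp (-t ^ 2)) x) x := by
  rw [iteratedDeriv_succ]
  have h : ContDiff ℝ ((n + 1 : ℕ) : WithTop ℕ∞) fun t : ℝ => Real.exp (-t ^ 2) := by fun_prop
  exact ((h.differentiable_iteratedDeriv n (by exact_mod_cast n.lt_succ_self)) x).hasDerivAt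

/-- The relation w' = -2x w for w = e^{-x²}, differentiated n + 1 times. It yields the three-term
recurrence for H_n. -/
theorem iteratedDeriv_exp_neg_sq_add_two (n : ℕ) (x : ℝ) :
    iteratedDeriv (n + 2) (fun t : ℝ => Real.exp (-t ^ 2)) x =
      -2 * x * iteratedDeriv (n + 1) (fun t : ℝ => Real.exp (-t ^ 2)) x -
        2 * (n + 1) * iteratedDeriv n (fun t : ℝ => Real.exp (-t ^ 2)) x := by
  have h1 : ∀ t : ℝ, HasDerivAt (fun t : ℝ => Real.exp (-t ^ 2))
      (Real.exp (-t ^ 2) * (-(2 * t))) t := fun t => by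
    simpa using ((hasDerivAt_pow 2 t).neg).exp
  induction n generalizing x with
  | zero =>
    have h2 : iteratedDeriv 1 (fun t : ℝ => Real.exp (-t ^ 2)) =
        fun t => Real.exp (-t ^ 2) * (-(2 * t)) := by
      rw [iteratedDeriv_one]; exact funext fun t => (h1 t).deriv
    have h3 := hasDerivAt_iteratedDeriv_exp_neg_sq 1 x
    have h4 := ((h1 x).mul (((hasDerivAt_id x).const_mul 2).neg))
    rw [h2] at h3
    simp only [zero_add, h2, iteratedDeriv_zero]
    rw [h3.unique h4]
    simp
    ring
  | succ n ih =>
    have h3 := hasDerivAt_iteratedDeriv_exp_neg_sq (n + 2) x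
    rw [funext ih] at h3
    have h4 := (((hasDerivAt_id x).const_mul (-2)).mul
      (hasDerivAt_iteratedDeriv_exp_neg_sq (n + 1) x)).sub
      ((hasDerivAt_iteratedDeriv_exp_neg_sq n x).const_mul (2 * ((n : ℝ) + 1)))
    rw [show n + 1 + 2 = n + 2 + 1 from rfl, h3.unique h4]
    push_cast
    simp
    ring

theorem hermiteH_zero (x : ℝ) : hermiteH 0 x = 1 := by
  simp [hermiteH, ← Real.exp_add]

theorem hermiteH_add_two (n : ℕ) (x : ℝ) :
    hermiteH (n + 2) x = 2 * x * hermiteH (n + 1) x - 2 * (n + 1) * hermiteH n x := by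
  simp only [hermiteH, iteratedDeriv_exp_neg_sq_add_two]
  ring

theorem hasDerivAt_hermiteH (n : ℕ) (x : ℝ) :
    HasDerivAt (hermiteH n) (2 * x * hermiteH n x - hermiteH (n + 1) x) x := by
  have h1 : HasDerivAt (fun t : ℝ => (-1) ^ n * Real.exp (t ^ 2))
      ((-1) ^ n * (Real.exp (x ^ 2) * (2 * x))) x := by
    simpa using ((hasDerivAt_pow 2 x).exp).const_mul ((-1 : ℝ) ^ n)
  convert! h1.mul (hasDerivAt_iteratedDeriv_exp_neg_sq n x) using 1
  simp only [hermiteH]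
  ring

theorem hermiteH_one (x : ℝ) : hermiteH 1 x = 2 * x := by
  have h := hasDerivAt_hermiteH 0 x
  rw [funext hermiteH_zero] at h
  have := h.unique (hasDerivAt_const x (1 : ℝ))
  simp at this
  linarith

theorem hermiteH_eq_polynomial (n : ℕ) : ∃ P : Polynomial ℝ, ∀ x, hermiteH n x = P.eval x := by
  induction n using Nat.twoStepInduction with
  | zero => exact ⟨1, fun x => by simp [hermiteH_zero]⟩
  | one => exact ⟨2 * Polynomial.X, fun x => by simp [hermiteH_one]⟩
  | more n ih1 ih2 =>
    obtain ⟨P, hP⟩ := ih1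
    obtain ⟨Q, hQ⟩ := ih2
    exact ⟨2 * Polynomial.X * Q - Polynomial.C (2 * ((n : ℝ) + 1)) * P, fun x => by
      simp [hermiteH_add_two, hP, hQ]⟩

theorem hermiteH_odd_zero (n : ℕ) : hermiteH (2 * n + 1) 0 = 0 := by
  induction n with
  | zero => simp [hermiteH_one]
  | succ n ih =>
    rw [show 2 * (n + 1) + 1 = 2 * n + 1 + 2 by ring, hermiteH_add_two, ih]
    simp

theorem hermiteH_even_zero (n : ℕ) :
    hermiteH (2 * n) 0 = (-1) ^ n * (2 * n).factorial / n.factorial := by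
  induction n with
  | zero => simp [hermiteH_zero]
  | succ n ih =>
    rw [show 2 * (n + 1) = 2 * n + 2 by ring, hermiteH_add_two, ih,
      Nat.factorial_succ (2 * n + 1), Nat.factorial_succ (2 * n), Nat.factorial_succ n]
    have : (n.factorial : ℝ) ≠ 0 := by positivity
    push_cast
    field_simp
    ring

/-- The normalizing factor of `φ_n`. -/
noncomputable def hermiteNorm (n : ℕ) : ℝ := 1 / Real.sqrt (2 ^ n * (n.factorial : ℝ) * Real.sqrt Real.pi)

theorem hermiteNorm_pos (n : ℕ) : 0 < hermiteNorm n := by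
  unfold hermiteNorm; positivity

theorem hermiteNorm_eq_mul_succ (n : ℕ) :
    hermiteNorm n = Real.sqrt (2 * (n + 1)) * hermiteNorm (n + 1) := by
  have h : (2 : ℝ) ^ (n + 1) * ((n + 1).factorial : ℝ) * Real.sqrt Real.pi =
      (2 * (n + 1)) * (2 ^ n * (n.factorial : ℝ) * Real.sqrt Real.pi) := by
    rw [Nat.factorial_succ]; push_cast; ring
  have h1 : 0 < Real.sqrt (2 ^ n * (n.factorial : ℝ) * Real.sqrt Real.pi) := by positivity
  have h2 : 0 < Real.sqrt (2 * ((n : ℝ) + 1)) := by positivity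
  rw [hermiteNorm, hermiteNorm, h, Real.sqrt_mul (by positivity) (2 ^ n * _ * _)]
  field_simp

theorem hermitePhi_eq (n : ℕ) (x : ℝ) :
    hermitePhi n x = hermiteNorm n * Real.exp (-x ^ 2 / 2) * hermiteH n x := rfl

theorem hasDerivAt_exp_neg_sq_div_two (x : ℝ) :
    HasDerivAt (fun t : ℝ => Real.exp (-t ^ 2 / 2)) (Real.exp (-x ^ 2 / 2) * -x) x := by
  convert! (((hasDerivAt_pow 2 x).neg).div_const 2).exp using 1
  simp
  ring

/-- Creation relation. Together with the annihilation relation `hasDerivAt_hermitePhi_succ` it is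
the Dirac system for U_{n+1}, the factor √(2(n+1)) being the eigenvalue. -/
theorem hasDerivAt_hermitePhi (n : ℕ) (x : ℝ) :
    HasDerivAt (hermitePhi n)
      (x * hermitePhi n x - Real.sqrt (2 * (n + 1)) * hermitePhi (n + 1) x) x := by
  convert! ((hasDerivAt_exp_neg_sq_div_two x).const_mul (hermiteNorm n)).mul
    (hasDerivAt_hermiteH n x) using 1
  simp only [hermitePhi_eq]
  rw [hermiteNorm_eq_mul_succ]
  ring

theorem hasDerivAt_hermitePhi_zero (x : ℝ) :
    HasDerivAt (hermitePhi 0) (-x * hermitePhi 0 x) x := by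
  convert! ((hasDerivAt_exp_neg_sq_div_two x).const_mul (hermiteNorm 0)).mul
    (hasDerivAt_hermiteH 0 x) using 1
  simp only [hermitePhi_eq, hermiteH_zero, zero_add, hermiteH_one]
  ring

theorem hasDerivAt_hermitePhi_succ (n : ℕ) (x : ℝ) :
    HasDerivAt (hermitePhi (n + 1))
      (Real.sqrt (2 * (n + 1)) * hermitePhi n x - x * hermitePhi (n + 1) x) x := by
  convert! ((hasDerivAt_exp_neg_sq_div_two x).const_mul (hermiteNorm (n + 1))).mul
    (hasDerivAt_hermiteH (n + 1) x) using 1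
  have h : Real.sqrt (2 * ((n : ℝ) + 1)) ^ 2 = 2 * (n + 1) := Real.sq_sqrt (by positivity)
  simp only [hermitePhi_eq, hermiteH_add_two, hermiteNorm_eq_mul_succ n]
  linear_combination (hermiteNorm (n + 1) * Real.exp (-x ^ 2 / 2) * hermiteH n x) * h

theorem continuous_hermitePhi (n : ℕ) : Continuous (hermitePhi n) :=
  continuous_iff_continuousAt.2 fun x => (hasDerivAt_hermitePhi n x).continuousAt

theorem integrable_polynomial_mul_exp_neg_sq (P : Polynomial ℝ) :
    Integrable fun x : ℝ => P.eval x * Real.exp (-x ^ 2) := by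
  induction P using Polynomial.induction_on' with
  | add P Q hP hQ =>
    convert! hP.add hQ using 1
    ext x
    simp [add_mul]
  | monomial n a =>
    have := (integrable_rpow_mul_exp_neg_mul_sq (b := 1) one_pos (s := n)
      (by linarith [n.cast_nonneg (α := ℝ)])).const_mul a
    simpa [mul_assoc] using this

theorem integrable_hermitePhi_sq (n : ℕ) : Integrable fun x => hermitePhi n x ^ 2 := by
  obtain ⟨P, hP⟩ := hermiteH_eq_polynomial n
  convert! (integrable_polynomial_mul_exp_neg_sq (P ^ 2)).const_mul (hermiteNorm n ^ 2) using 1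
  ext x
  rw [hermitePhi_eq, hP, Polynomial.eval_pow, mul_pow, mul_pow, ← Real.exp_nat_mul]
  push_cast
  ring_nf

theorem memLp_hermitePhi (n : ℕ) :
    MemLp (fun x => (hermitePhi n x : ℂ)) 2 (volume.restrict (Ioi 0)) := by
  rw [memLp_two_iff_integrable_sq_norm (f := fun x => (hermitePhi n x : ℂ))
    (Complex.continuous_ofReal.comp (continuous_hermitePhi n)).aestronglyMeasurable]
  simpa using (integrable_hermitePhi_sq n).restrict

theorem hermitePhi_odd_zero (n : ℕ) : hermitePhi (2 * n + 1) 0 = 0 := by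
  rw [hermitePhi_eq, hermiteH_odd_zero, mul_zero]

theorem hermitePhi_even_zero_ne_zero (n : ℕ) : hermitePhi (2 * n) 0 ≠ 0 := by
  rw [hermitePhi_eq, hermiteH_even_zero]
  have := (hermiteNorm_pos (2 * n)).ne'
  positivity

theorem one_div_hermitePhi_even_zero_sq (n : ℕ) :
    1 / hermitePhi (2 * n) 0 ^ 2 =
      4 ^ n * (n.factorial : ℝ) ^ 2 * Real.sqrt Real.pi / ((2 * n).factorial : ℝ) := by
  have h1 : hermiteNorm (2 * n) ^ 2 = 1 / (4 ^ n * ((2 * n).factorial : ℝ) * Real.sqrt Real.pi) := by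
    rw [hermiteNorm, div_pow, Real.sq_sqrt (by positivity), pow_mul]
    norm_num
  have h2 : ((-1 : ℝ) ^ n) ^ 2 = 1 := by rw [← pow_mul, mul_comm, pow_mul]; simp
  have h3 : 0 < Real.sqrt Real.pi := by positivity
  rw [hermitePhi_eq, hermiteH_even_zero, mul_pow, mul_pow, h1, div_pow, mul_pow, h2]
  simp
  field_simp

/-- Consecutive norms agree: (φ_n φ_{n+1})' = √(2(n+1)) (φ_n² - φ_{n+1}²), and the product vanishes
at infinity and at 0, where one of the two indices is odd. The Gaussian integral starts the
induction. -/
theorem integral_hermitePhi_sq (n : ℕ) : ∫ x in Ioi (0 : ℝ), hermitePhi n x ^ 2 = 1 / 2 := by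
  induction n with
  | zero =>
    have h : ∀ x, hermitePhi 0 x ^ 2 = 1 / Real.sqrt Real.pi * Real.exp (-1 * x ^ 2) := fun x => by
      rw [hermitePhi_eq, hermiteH_zero, mul_one, mul_pow, ← Real.exp_nat_mul, hermiteNorm, div_pow,
        Real.sq_sqrt (by positivity)]
      rw [pow_zero, Nat.factorial_zero]
      push_cast
      ring_nf
    simp_rw [h]
    rw [integral_const_mul, integral_gaussian_Ioi, div_one]
    have h3 : 0 < Real.sqrt Real.pi := by positivity
    field_simp
  | succ n ih =>
    set s := Real.sqrt (2 * ((n : ℝ) + 1)) with hs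
    have hs0 : s ≠ 0 := by positivity
    have hd : ∀ x, HasDerivAt (fun x => hermitePhi n x * hermitePhi (n + 1) x)
        (s * (hermitePhi n x ^ 2 - hermitePhi (n + 1) x ^ 2)) x := fun x => by
      convert! (hasDerivAt_hermitePhi n x).mul (hasDerivAt_hermitePhi_succ n x) using 1
      ring
    have hi : IntegrableOn (fun x => s * (hermitePhi n x ^ 2 - hermitePhi (n + 1) x ^ 2))
        (Ioi 0) :=
      (((integrable_hermitePhi_sq n).sub (integrable_hermitePhi_sq (n + 1))).const_mul s).integrableOn
    have hp : IntegrableOn (fun x => hermitePhi n x * hermitePhi (n + 1) x) (Ioi 0) := by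
      refine Integrable.mono' (Integrable.add (integrable_hermitePhi_sq n).integrableOn
        (integrable_hermitePhi_sq (n + 1)).integrableOn)
        ((continuous_hermitePhi n).mul (continuous_hermitePhi (n + 1))).aestronglyMeasurable
        (.of_forall fun x => ?_)
      simp only [Pi.add_apply, Real.norm_eq_abs]
      rw [abs_le]
      constructor <;> nlinarith [sq_nonneg (hermitePhi n x - hermitePhi (n + 1) x),
        sq_nonneg (hermitePhi n x + hermitePhi (n + 1) x), sq_nonneg (hermitePhi n x),
        sq_nonneg (hermitePhi (n + 1) x)]
    have hlim := tendsto_zero_of_hasDerivAt_of_integrableOn_Ioi (fun x _ => hd x) hi hp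
    have h := integral_Ioi_of_hasDerivAt_of_tendsto' (fun x _ => hd x) hi hlim
    have h0 : hermitePhi n 0 * hermitePhi (n + 1) 0 = 0 := by
      rcases Nat.even_or_odd' n with ⟨m, rfl | rfl⟩
      · rw [hermitePhi_odd_zero, mul_zero]
      · rw [hermitePhi_odd_zero, zero_mul]
    rw [h0, integral_const_mul, integral_sub (integrable_hermitePhi_sq n).integrableOn
      (integrable_hermitePhi_sq (n + 1)).integrableOn, ih] at h
    simp [hs0] at h
    linarith

/-! ### The numbers √(2|n|) sign n. -/

theorem axisEigenvalue_of_nonneg {n : ℤ} (hn : 0 ≤ n) :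
    axisEigenvalue n = Real.sqrt (2 * (n : ℝ)) := by
  rcases hn.eq_or_lt with rfl | h
  · simp [axisEigenvalue]
  · rw [axisEigenvalue, Int.sign_eq_one_of_pos h, abs_of_pos (by exact_mod_cast h)]
    simp

theorem axisEigenvalue_neg (n : ℤ) : axisEigenvalue (-n) = -axisEigenvalue n := by
  simp [axisEigenvalue]

theorem strictMono_axisEigenvalue : StrictMono axisEigenvalue := by
  have key : ∀ a b : ℤ, 0 ≤ a → a < b → axisEigenvalue a < axisEigenvalue b := fun a b ha hab => by
    rw [axisEigenvalue_of_nonneg ha, axisEigenvalue_of_nonneg (ha.trans hab.le)]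
    have h1 : (0 : ℝ) ≤ a := by exact_mod_cast ha
    have h2 : (a : ℝ) < b := by exact_mod_cast hab
    exact Real.sqrt_lt_sqrt (by linarith) (by linarith)
  intro a b hab
  rcases le_or_gt 0 a with ha | ha
  · exact key a b ha hab
  rcases le_or_gt b 0 with hb | hb
  · have := key (-b) (-a) (by omega) (by omega)
    rw [axisEigenvalue_neg, axisEigenvalue_neg] at this
    linarith
  · have h1 := key 0 (-a) le_rfl (by omega)
    have h2 := key 0 b le_rfl hb
    have h0 : axisEigenvalue 0 = 0 := by simp [axisEigenvalue]
    rw [axisEigenvalue_neg] at h1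
    linarith

theorem halfAxisEigenvalue_eq (k : ℤ) : halfAxisEigenvalue k = axisEigenvalue (2 * k) := by
  have h : (2 : ℝ) * |((2 * k : ℤ) : ℝ)| = 2 ^ 2 * |(k : ℝ)| := by
    push_cast
    rw [abs_mul, abs_two]
    ring
  rw [halfAxisEigenvalue, axisEigenvalue, h, Real.sqrt_mul (by norm_num),
    Real.sqrt_sq (by norm_num), Int.sign_mul, show Int.sign 2 = 1 from rfl, one_mul]

theorem exists_eq_axisEigenvalue {lam : ℂ} {m : ℕ} (h : lam ^ 2 = 2 * m) :
    ∃ n : ℤ, lam = (axisEigenvalue n : ℂ) := by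
  have hs : ((axisEigenvalue m : ℝ) : ℂ) ^ 2 = 2 * m := by
    rw [axisEigenvalue_of_nonneg (by positivity), ← Complex.ofReal_pow,
      Real.sq_sqrt (by positivity)]
    simp
  rcases sq_eq_sq_iff_eq_or_eq_neg.1 (h.trans hs.symm) with h | h
  · exact ⟨m, h⟩
  · exact ⟨-m, by rw [axisEigenvalue_neg, h]; simp⟩

/-! ### The vector functions U_n and their values at 0. -/

theorem vecU_natCast_succ (m : ℕ) (x : ℝ) :
    vecU (m + 1 : ℤ) x = ![(hermitePhi m x : ℂ), (hermitePhi (m + 1) x : ℂ)] := by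
  have h : ((m : ℤ) + 1).natAbs = m + 1 := by omega
  rw [vecU, if_pos (by omega), h, Nat.add_sub_cancel]

theorem vecU_neg_natCast_succ (m : ℕ) (x : ℝ) :
    vecU (-(m + 1 : ℤ)) x = ![-(hermitePhi m x : ℂ), (hermitePhi (m + 1) x : ℂ)] := by
  have h : (-((m : ℤ) + 1)).natAbs = m + 1 := by omega
  rw [vecU, if_neg (by omega), if_neg (by omega), h, Nat.add_sub_cancel]

theorem vecU_zero (x : ℝ) : vecU 0 x = ![0, (hermitePhi 0 x : ℂ)] := by
  simp [vecU]

theorem eq_zero_or_eq_or_eq_neg_natCast_succ (n : ℤ) : n = 0 ∨ ∃ m : ℕ, n = m + 1 ∨ n = -(m + 1 : ℤ) := by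
  rcases lt_trichotomy n 0 with h | h | h
  · exact .inr ⟨(-n - 1).toNat, .inr (by omega)⟩
  · exact .inl h
  · exact .inr ⟨(n - 1).toNat, .inl (by omega)⟩

theorem isClassicalSolution_vecU (n : ℤ) :
    IsClassicalSolution (axisEigenvalue n : ℂ) (vecU n) := by
  rcases eq_zero_or_eq_or_eq_neg_natCast_succ n with rfl | ⟨m, rfl | rfl⟩
  · refine ⟨fun x _ => ?_, fun x _ => ?_⟩
    · simpa [vecU_zero, axisEigenvalue] using hasDerivAt_const x (0 : ℂ)
    · simpa [vecU_zero, axisEigenvalue] using (hasDerivAt_hermitePhi_zero x).ofReal_comp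
  · have hl : axisEigenvalue (m + 1) = Real.sqrt (2 * (m + 1)) := by
      rw [axisEigenvalue_of_nonneg (by positivity)]; push_cast; rfl
    rw [hl]
    refine ⟨fun x _ => ?_, fun x _ => ?_⟩
    · simpa [vecU_natCast_succ] using (hasDerivAt_hermitePhi m x).ofReal_comp
    · simpa [vecU_natCast_succ] using (hasDerivAt_hermitePhi_succ m x).ofReal_comp
  · have hl : axisEigenvalue (-(m + 1)) = -Real.sqrt (2 * (m + 1)) := by
      rw [axisEigenvalue_neg, axisEigenvalue_of_nonneg (by positivity)]; push_cast; rfl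
    rw [hl]
    refine ⟨fun x _ => ?_, fun x _ => ?_⟩
    · simp only [vecU_neg_natCast_succ]
      convert! (hasDerivAt_hermitePhi m x).ofReal_comp.neg using 1
      simp
      ring
    · simp only [vecU_neg_natCast_succ]
      convert! (hasDerivAt_hermitePhi_succ m x).ofReal_comp using 1
      simp

theorem isL2_vecU (n : ℤ) : IsL2 (vecU n) := by
  intro k
  rcases eq_zero_or_eq_or_eq_neg_natCast_succ n with rfl | ⟨m, rfl | rfl⟩ <;> fin_cases k
  · simp [vecU_zero]
  · simpa [vecU_zero] using memLp_hermitePhi 0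
  · simpa [vecU_natCast_succ] using memLp_hermitePhi m
  · simpa [vecU_natCast_succ] using memLp_hermitePhi (m + 1)
  · simp only [vecU_neg_natCast_succ]
    exact (memLp_hermitePhi m).neg
  · simp only [vecU_neg_natCast_succ]
    exact memLp_hermitePhi (m + 1)

theorem continuous_vecU (n : ℤ) : Continuous (vecU n) := by
  have h : ∀ m, Continuous fun x => (hermitePhi m x : ℂ) := fun m =>
    Complex.continuous_ofReal.comp (continuous_hermitePhi m)
  refine continuous_pi fun k => ?_
  rcases eq_zero_or_eq_or_eq_neg_natCast_succ n with rfl | ⟨m, rfl | rfl⟩ <;> fin_cases k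
  · simpa [vecU_zero] using continuous_const
  · simpa [vecU_zero] using h 0
  · simpa [vecU_natCast_succ] using h m
  · simpa [vecU_natCast_succ] using h (m + 1)
  · simp only [vecU_neg_natCast_succ]
    exact (h m).neg
  · simp only [vecU_neg_natCast_succ]
    exact h (m + 1)

theorem hasBoundaryValue_vecU (n : ℤ) : HasBoundaryValue (vecU n) (vecU n 0) := fun k =>
  (((continuous_apply k).comp (continuous_vecU n)).tendsto 0).mono_left nhdsWithin_le_nhds

theorem vecU_even_at_zero (k : ℤ) : vecU (2 * k) 0 = ![0, (hermitePhi (2 * k.natAbs) 0 : ℂ)] := by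
  rcases eq_zero_or_eq_or_eq_neg_natCast_succ k with rfl | ⟨m, rfl | rfl⟩
  · simp [vecU_zero]
  · have := vecU_natCast_succ (2 * m + 1) 0
    have h : ((m : ℤ) + 1).natAbs = m + 1 := by omega
    rw [hermitePhi_odd_zero] at this
    rw [h, show (2 : ℤ) * (m + 1) = ((2 * m + 1 : ℕ) : ℤ) + 1 by push_cast; ring, this]
    simp [mul_add]
  · have := vecU_neg_natCast_succ (2 * m + 1) 0
    have h : (-((m : ℤ) + 1)).natAbs = m + 1 := by omega
    rw [hermitePhi_odd_zero] at this
    rw [h, show (2 : ℤ) * -(m + 1) = -(((2 * m + 1 : ℕ) : ℤ) + 1) by push_cast; ring, this]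
    simp [mul_add]

theorem vecU_odd_at_zero (k : ℤ) : vecU (2 * k + 1) 0 0 ≠ 0 ∧ vecU (2 * k + 1) 0 1 = 0 := by
  rcases le_or_gt 0 k with hk | hk
  · lift k to ℕ using hk
    have := vecU_natCast_succ (2 * k) 0
    push_cast at this
    rw [this]
    simp [hermitePhi_odd_zero, hermitePhi_even_zero_ne_zero]
  · obtain ⟨m, rfl⟩ : ∃ m : ℕ, k = -(m + 1 : ℤ) := ⟨(-k - 1).toNat, by omega⟩
    have := vecU_neg_natCast_succ (2 * m) 0
    rw [show 2 * -((m : ℤ) + 1) + 1 = -(((2 * m : ℕ) : ℤ) + 1) by push_cast; ring, this]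
    simp [hermitePhi_odd_zero, hermitePhi_even_zero_ne_zero]

theorem vecU_at_zero_ne_zero (n : ℤ) : vecU n 0 ≠ 0 := by
  rcases Int.even_or_odd' n with ⟨k, rfl | rfl⟩
  · intro h
    have := congrFun h 1
    rw [vecU_even_at_zero] at this
    simp [hermitePhi_even_zero_ne_zero] at this
  · intro h
    exact (vecU_odd_at_zero k).1 (congrFun h 0)

/-! ### Eigenfunctions and eigenvalues under a general boundary condition. -/

/-- A vector in `ℂ²` with vanishing determinant against a nonzero one is a multiple of it. -/
theorem exists_eq_smul_of_det_eq_zero {v u : Fin 2 → ℂ} (hu : u ≠ 0)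
    (h : v 0 * u 1 - v 1 * u 0 = 0) : ∃ c : ℂ, v = c • u := by
  by_cases h0 : u 0 = 0
  · have h1 : u 1 ≠ 0 := fun h1 => hu (by ext k; fin_cases k <;> simp [h0, h1])
    refine ⟨v 1 / u 1, ?_⟩
    have : v 0 = 0 := by simpa [h0, h1] using h
    ext k
    fin_cases k <;> simp [h0, h1, this]
  · refine ⟨v 0 / u 0, ?_⟩
    ext k
    fin_cases k
    · simp [h0]
    · simp
      field_simp
      linear_combination -h

/-- Square integrable solutions for an axis eigenvalue are multiples of `U_n`. -/
theorem exists_eq_smul_vecU {n : ℤ} {y : ℝ → Fin 2 → ℂ} {v : Fin 2 → ℂ}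
    (h : IsClassicalSolution (axisEigenvalue n : ℂ) y) (hy : IsL2 y) (hv : HasBoundaryValue y v) :
    ∃ c : ℂ, v = c • vecU n 0 ∧ ∀ x, 0 < x → y x = c • vecU n x := by
  have hU := hasBoundaryValue_vecU n
  -- The Wronskian vanishes on (0, ∞), hence also in the limit at 0. The boundary values are
  -- therefore proportional, and uniqueness for zero boundary data extends this to the solutions.
  have hW : v 0 * vecU n 0 1 - v 1 * vecU n 0 0 = 0 := by
    refine tendsto_nhds_unique (((hv 0).mul (hU 1)).sub ((hv 1).mul (hU 0)))
      (tendsto_const_nhds.congr' ?_)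
    filter_upwards [self_mem_nhdsWithin] with x hx
    exact (h.wronskian_eq_zero (isClassicalSolution_vecU n) hy (isL2_vecU n) hx).symm
  obtain ⟨c, hc⟩ := exists_eq_smul_of_det_eq_zero (vecU_at_zero_ne_zero n) hW
  refine ⟨c, hc, fun x hx => ?_⟩
  refine sub_eq_zero.1 ((h.sub ((isClassicalSolution_vecU n).const_smul c)).eq_zero
    (fun k => ?_) hx)
  have := (hv k).sub ((hU k).const_mul c)
  simpa [hc] using this

theorem IsL2.congr {y z : ℝ → Fin 2 → ℂ} (hy : IsL2 y) (h : ∀ x, 0 < x → z x = y x) : IsL2 z :=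
  fun k => (memLp_congr_ae ((ae_restrict_iff' measurableSet_Ioi).2
    (.of_forall fun x hx => by rw [h x hx]))).2 (hy k)

theorem IsL2.const_smul {y : ℝ → Fin 2 → ℂ} (hy : IsL2 y) (c : ℂ) : IsL2 fun x => c • y x :=
  fun k => (hy k).const_mul c

theorem HasBoundaryValue.congr {y z : ℝ → Fin 2 → ℂ} {v : Fin 2 → ℂ} (hy : HasBoundaryValue y v)
    (h : ∀ x, 0 < x → z x = y x) : HasBoundaryValue z v := fun k =>
  (hy k).congr' (by filter_upwards [self_mem_nhdsWithin] with x hx; rw [h x hx])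

theorem HasBoundaryValue.const_smul {y : ℝ → Fin 2 → ℂ} {v : Fin 2 → ℂ}
    (hy : HasBoundaryValue y v) (c : ℂ) : HasBoundaryValue (fun x => c • y x) (c • v) :=
  fun k => (hy k).const_mul c

/-- The eigenfunctions for an axis eigenvalue whose `U_n` satisfies the boundary condition. -/
theorem isEigenfunction_iff {α : ℝ} {n : ℤ}
    (hα : vecU n 0 0 * (Real.cos α : ℂ) + vecU n 0 1 * (Real.sin α : ℂ) = 0)
    (y : ℝ → Fin 2 → ℂ) :
    IsEigenfunction pLin qLin α (axisEigenvalue n : ℂ) y ↔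
      ∃ c : ℂ, c ≠ 0 ∧ ∀ x : ℝ, 0 < x → y x = c • vecU n x := by
  constructor
  · rintro ⟨⟨hL2, hac, -, v, hv, -⟩, hs, x, hx, hyx⟩
    obtain ⟨c, -, hc⟩ := exists_eq_smul_vecU (isClassicalSolution_of_solvesSystem hac hs) hL2 hv
    refine ⟨c, ?_, hc⟩
    rintro rfl
    exact hyx (by simpa using hc x hx)
  · rintro ⟨c, hc, hy⟩
    have hsol := ((isClassicalSolution_vecU n).const_smul c).congr hy
    have hL2 : IsL2 y := ((isL2_vecU n).const_smul c).congr hy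
    refine ⟨⟨hL2, hsol.isLocallyAC, (hL2.const_smul _).congr fun x hx => hsol.diracExpr_eq hx,
      c • vecU n 0, ((hasBoundaryValue_vecU n).const_smul c).congr hy, ?_⟩, hsol.solvesSystem, ?_⟩
    · simp only [Pi.smul_apply, smul_eq_mul]
      linear_combination c * hα
    · by_contra! h
      refine vecU_at_zero_ne_zero n ?_
      have h0 : ∀ x, 0 < x → vecU n x = 0 := fun x hx => by
        have := h x hx
        rw [hy x hx] at this
        exact (smul_eq_zero.1 this).resolve_left hc
      ext k
      refine tendsto_nhds_unique (hasBoundaryValue_vecU n k) (tendsto_const_nhds.congr' ?_)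
      filter_upwards [self_mem_nhdsWithin] with x hx
      rw [h0 x hx]

/-- Eigenvalues under a Dirichlet type condition are axis eigenvalues. -/
theorem exists_axisEigenvalue_of_isEigenfunction {α : ℝ} {lam : ℂ} {y : ℝ → Fin 2 → ℂ}
    (hα : ∀ v : Fin 2 → ℂ, v 0 * (Real.cos α : ℂ) + v 1 * (Real.sin α : ℂ) = 0 → v 0 * v 1 = 0)
    (h : IsEigenfunction pLin qLin α lam y) : ∃ n : ℤ, lam = (axisEigenvalue n : ℂ) := by
  obtain ⟨⟨hL2, hac, -, v, hv, hbc⟩, hs, x, hx, hyx⟩ := h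
  have hsol := isClassicalSolution_of_solvesSystem hac hs
  -- For `lam = 0` the pair below forgets y₁, but 0 is already an axis eigenvalue. Otherwise y₁ is
  -- recovered from lam y₁ = y₂' + x y₂.
  by_cases hlam : lam = 0
  · exact ⟨0, by simp [axisEigenvalue, hlam]⟩
  have hpair : IsLadderPair (lam ^ 2) (fun x => y x 1) (fun x => lam * y x 0) :=
    { deriv_fst := hsol.2
      deriv_snd := fun x hx => by
        convert! (hsol.1 x hx).const_mul lam using 1
        ring
      memLp_fst := hL2 1
      memLp_snd := (hL2 0).const_mul lam }
  rcases hpair.eq_zero_or_exists_nat (hv 1) ((hv 0).const_mul lam)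
    (by linear_combination lam * hα v hbc) with h0 | ⟨m, hm⟩
  · refine absurd ?_ hyx
    have h1 := (hsol.2 x hx).unique ((hasDerivAt_const x (0 : ℂ)).congr_of_eventuallyEq
      (by filter_upwards [Ioi_mem_nhds hx] with t ht using h0 t ht))
    have h2 : y x 1 = 0 := h0 x hx
    have h3 : y x 0 = 0 := by simpa [h2, hlam] using h1
    ext k
    fin_cases k
    · exact h3
    · exact h2
  · exact exists_eq_axisEigenvalue hm

/-- An eigenfunction is a nonzero multiple of some U_n, so its boundary condition passes to U_n. The
hypothesis `hα` is the product condition that the ladder argument needs. -/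
theorem isEigenvalue_iff {α : ℝ}
    (hα : ∀ v : Fin 2 → ℂ, v 0 * (Real.cos α : ℂ) + v 1 * (Real.sin α : ℂ) = 0 → v 0 * v 1 = 0)
    (lam : ℂ) : IsEigenvalue pLin qLin α lam ↔ ∃ n : ℤ, lam = (axisEigenvalue n : ℂ) ∧
      vecU n 0 0 * (Real.cos α : ℂ) + vecU n 0 1 * (Real.sin α : ℂ) = 0 := by
  constructor
  · rintro ⟨y, hy⟩
    obtain ⟨n, rfl⟩ := exists_axisEigenvalue_of_isEigenfunction hα hy
    refine ⟨n, rfl, ?_⟩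
    obtain ⟨⟨hL2, hac, -, v, hv, hbc⟩, hs, x, hx, hyx⟩ := hy
    obtain ⟨c, hcv, hc⟩ := exists_eq_smul_vecU (isClassicalSolution_of_solvesSystem hac hs) hL2 hv
    have hc0 : c ≠ 0 := by
      rintro rfl
      exact hyx (by simpa using hc x hx)
    rw [hcv] at hbc
    simp only [Pi.smul_apply, smul_eq_mul] at hbc
    refine (mul_eq_zero.1 ?_).resolve_left hc0
    linear_combination hbc
  · rintro ⟨n, rfl, hn⟩
    exact ⟨vecU n, (isEigenfunction_iff hn _).2 ⟨1, one_ne_zero, by simp⟩⟩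

/-! ### The boundary conditions α = 0 and α = π/2. -/

theorem boundaryCondition_even (k : ℤ) :
    vecU (2 * k) 0 0 * (Real.cos 0 : ℂ) + vecU (2 * k) 0 1 * (Real.sin 0 : ℂ) = 0 := by
  simp [vecU_even_at_zero]

theorem boundaryCondition_odd (k : ℤ) :
    vecU (2 * k + 1) 0 0 * (Real.cos (Real.pi / 2) : ℂ) +
      vecU (2 * k + 1) 0 1 * (Real.sin (Real.pi / 2) : ℂ) = 0 := by
  rw [(vecU_odd_at_zero k).2, Real.cos_pi_div_two]
  simp

theorem isEigenvalue_zero_iff (lam : ℂ) :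
    IsEigenvalue pLin qLin 0 lam ↔ ∃ k : ℤ, lam = (axisEigenvalue (2 * k) : ℂ) := by
  rw [isEigenvalue_iff fun v hv => by simp_all]
  constructor
  · rintro ⟨n, rfl, hn⟩
    rcases Int.even_or_odd' n with ⟨k, rfl | rfl⟩
    · exact ⟨k, rfl⟩
    · exact absurd (by simpa using hn) (vecU_odd_at_zero k).1
  · rintro ⟨k, rfl⟩
    exact ⟨2 * k, rfl, boundaryCondition_even k⟩

theorem isEigenvalue_pi_div_two_iff (lam : ℂ) :
    IsEigenvalue pLin qLin (Real.pi / 2) lam ↔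
      ∃ k : ℤ, lam = (axisEigenvalue (2 * k + 1) : ℂ) := by
  rw [isEigenvalue_iff fun v hv => by
    rw [Real.cos_pi_div_two, Real.sin_pi_div_two] at hv; simp_all]
  constructor
  · rintro ⟨n, rfl, hn⟩
    rcases Int.even_or_odd' n with ⟨k, rfl | rfl⟩
    · rw [vecU_even_at_zero, Real.cos_pi_div_two, Real.sin_pi_div_two] at hn
      simp [hermitePhi_even_zero_ne_zero] at hn
    · exact ⟨k, rfl⟩
  · rintro ⟨k, rfl⟩
    exact ⟨2 * k + 1, rfl, boundaryCondition_odd k⟩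

/-! ### The normalized solutions V_n and the norming constants. -/

/-- The factor relating `V_n` to `U_{2n}`. -/
theorem vecV_factor_ne_zero (n : ℤ) : -(1 / (hermitePhi (2 * n.natAbs) 0 : ℂ)) ≠ 0 := by
  simp [hermitePhi_even_zero_ne_zero]

theorem isEigenfunction_even_iff (n : ℤ) (y : ℝ → Fin 2 → ℂ) :
    IsEigenfunction pLin qLin 0 (halfAxisEigenvalue n : ℂ) y ↔
      ∃ c : ℂ, c ≠ 0 ∧ ∀ x : ℝ, 0 < x → y x = c • vecU (2 * n) x := by
  rw [halfAxisEigenvalue_eq, isEigenfunction_iff (boundaryCondition_even n)]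

theorem isEigenfunction_even_iff_vecV (n : ℤ) (y : ℝ → Fin 2 → ℂ) :
    IsEigenfunction pLin qLin 0 (halfAxisEigenvalue n : ℂ) y ↔
      ∃ c : ℂ, c ≠ 0 ∧ ∀ x : ℝ, 0 < x → y x = c • vecV n x := by
  have hd := vecV_factor_ne_zero n
  rw [isEigenfunction_even_iff]
  constructor
  · rintro ⟨c, hc, h⟩
    refine ⟨c / -(1 / (hermitePhi (2 * n.natAbs) 0 : ℂ)), div_ne_zero hc hd, fun x hx => ?_⟩
    rw [h x hx, vecV, smul_smul, div_mul_cancel₀ _ hd]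
  · rintro ⟨c, hc, h⟩
    refine ⟨c * -(1 / (hermitePhi (2 * n.natAbs) 0 : ℂ)), mul_ne_zero hc hd, fun x hx => ?_⟩
    rw [h x hx, vecV, smul_smul]

theorem hasBoundaryValue_vecV (n : ℤ) :
    HasBoundaryValue (vecV n) ![Complex.sin 0, -Complex.cos 0] := by
  have h := (hasBoundaryValue_vecU (2 * n)).const_smul (-(1 / (hermitePhi (2 * n.natAbs) 0 : ℂ)))
  have hv : -(1 / (hermitePhi (2 * n.natAbs) 0 : ℂ)) • vecU (2 * n) 0 =
      ![Complex.sin 0, -Complex.cos 0] := by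
    rw [vecU_even_at_zero]
    ext k
    fin_cases k <;> simp [hermitePhi_even_zero_ne_zero]
  rwa [hv] at h

theorem isClassicalSolution_vecV (n : ℤ) :
    IsClassicalSolution (halfAxisEigenvalue n : ℂ) (vecV n) := by
  rw [halfAxisEigenvalue_eq]
  exact (isClassicalSolution_vecU (2 * n)).const_smul _

theorem isCauchySolution_iff (n : ℤ) (y : ℝ → Fin 2 → ℂ) :
    IsCauchySolution pLin qLin (halfAxisEigenvalue n : ℂ) 0 y ↔
      ∀ x : ℝ, 0 < x → y x = vecV n x := by
  constructor
  · rintro ⟨hac, hs, hv⟩ x hx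
    refine sub_eq_zero.1 (((isClassicalSolution_of_solvesSystem hac hs).sub
      (isClassicalSolution_vecV n)).eq_zero (fun k => ?_) hx)
    simpa using (hv k).sub (hasBoundaryValue_vecV n k)
  · intro h
    have hsol := (isClassicalSolution_vecV n).congr h
    exact ⟨hsol.isLocallyAC, hsol.solvesSystem, (hasBoundaryValue_vecV n).congr h⟩

theorem norm_sq_vecV (n : ℤ) (x : ℝ) :
    ‖vecV n x 0‖ ^ 2 + ‖vecV n x 1‖ ^ 2 =
      1 / hermitePhi (2 * n.natAbs) 0 ^ 2 *
        (‖vecU (2 * n) x 0‖ ^ 2 + ‖vecU (2 * n) x 1‖ ^ 2) := by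
  simp [vecV, mul_pow]
  ring

theorem integrableOn_norm_sq_vecV (n : ℤ) :
    IntegrableOn (fun x : ℝ => ‖vecV n x 0‖ ^ 2 + ‖vecV n x 1‖ ^ 2) (Ioi (0 : ℝ)) := by
  have h : ∀ k, IntegrableOn (fun x => ‖vecU (2 * n) x k‖ ^ 2) (Ioi (0 : ℝ)) := fun k =>
    (memLp_two_iff_integrable_sq_norm (isL2_vecU (2 * n) k).1).1 (isL2_vecU (2 * n) k)
  simp_rw [norm_sq_vecV]
  exact ((h 0).add (h 1)).const_mul _

/-- U_0 has a single nonzero component, so its squared norm is 1/2, half that of the other U_{2n}.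
-/
theorem normingConstant_zero : normingConstant 0 = Real.sqrt Real.pi / 2 := by
  have h := one_div_hermitePhi_even_zero_sq 0
  simp only [normingConstant, norm_sq_vecV]
  rw [integral_const_mul]
  simp only [mul_zero, Int.natAbs_zero] at h ⊢
  rw [h]
  simp [vecU_zero, integral_hermitePhi_sq]
  ring

theorem norm_sq_vecU {n : ℤ} {m : ℕ} (h : n.natAbs = m + 1) (x : ℝ) :
    ‖vecU n x 0‖ ^ 2 + ‖vecU n x 1‖ ^ 2 = hermitePhi m x ^ 2 + hermitePhi (m + 1) x ^ 2 := by
  obtain rfl | rfl : n = m + 1 ∨ n = -(m + 1 : ℤ) := by omega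
  · simp [vecU_natCast_succ]
  · rw [vecU_neg_natCast_succ]
    simp

theorem normingConstant_of_ne_zero {n : ℤ} (hn : n ≠ 0) :
    normingConstant n = 1 / hermitePhi (2 * n.natAbs) 0 ^ 2 := by
  -- The components of U_{2n} are, up to sign, φ_{2|n|-1} and φ_{2|n|}; each contributes 1/2.
  have h : (2 * n).natAbs = (2 * n.natAbs - 1) + 1 := by omega
  simp only [normingConstant, norm_sq_vecV, norm_sq_vecU h]
  rw [integral_const_mul, integral_add (integrable_hermitePhi_sq _).restrict
    (integrable_hermitePhi_sq _).restrict, integral_hermitePhi_sq, integral_hermitePhi_sq]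
  norm_num

end DiracLinear

theorem mainTheorem6 :
    -- the eigenvalues of `L(0, x, 0)`
    (∀ lam : ℂ, DiracLinear.IsEigenvalue DiracLinear.pLin DiracLinear.qLin 0 lam ↔
      ∃ k : ℤ, lam = (DiracLinear.halfAxisEigenvalue k : ℂ)) ∧
    (∀ k : ℤ, DiracLinear.halfAxisEigenvalue k = DiracLinear.axisEigenvalue (2 * k)) ∧
    StrictMono DiracLinear.halfAxisEigenvalue ∧
    -- its eigenfunctions, each eigenvalue being simple
    (∀ n : ℤ, DiracLinear.hermitePhi (2 * n.natAbs) 0 ≠ 0) ∧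
    (∀ n : ℤ, DiracLinear.IsEigenfunction DiracLinear.pLin DiracLinear.qLin 0
        (DiracLinear.halfAxisEigenvalue n : ℂ) (DiracLinear.vecU (2 * n)) ∧
      DiracLinear.IsEigenfunction DiracLinear.pLin DiracLinear.qLin 0
        (DiracLinear.halfAxisEigenvalue n : ℂ) (DiracLinear.vecV n) ∧
      ∀ y : ℝ → Fin 2 → ℂ,
        DiracLinear.IsEigenfunction DiracLinear.pLin DiracLinear.qLin 0
            (DiracLinear.halfAxisEigenvalue n : ℂ) y ↔
          ∃ c : ℂ, c ≠ 0 ∧ ∀ x : ℝ, 0 < x → y x = c • DiracLinear.vecV n x) ∧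
    -- `V_n` is the unique solution of the Cauchy problem at `λ_n`
    (∀ n : ℤ, ∀ y : ℝ → Fin 2 → ℂ,
      DiracLinear.IsCauchySolution DiracLinear.pLin DiracLinear.qLin
          (DiracLinear.halfAxisEigenvalue n : ℂ) 0 y ↔
        ∀ x : ℝ, 0 < x → y x = DiracLinear.vecV n x) ∧
    -- the norming constants
    (∀ n : ℤ, MeasureTheory.IntegrableOn
      (fun x : ℝ => ‖DiracLinear.vecV n x 0‖ ^ 2 + ‖DiracLinear.vecV n x 1‖ ^ 2)
      (Set.Ioi (0 : ℝ))) ∧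
    DiracLinear.normingConstant 0 = Real.sqrt Real.pi / 2 ∧
    (∀ n : ℕ, 1 ≤ n →
      DiracLinear.normingConstant (-(n : ℤ)) = DiracLinear.normingConstant (n : ℤ) ∧
      DiracLinear.normingConstant (n : ℤ) = 1 / |DiracLinear.hermitePhi (2 * n) 0| ^ 2 ∧
      DiracLinear.normingConstant (n : ℤ) =
        4 ^ n * (n.factorial : ℝ) ^ 2 * Real.sqrt Real.pi / ((2 * n).factorial : ℝ)) ∧
    -- the eigenvalues and eigenfunctions of `L(0, x, π/2)`
    (∀ lam : ℂ, DiracLinear.IsEigenvalue DiracLinear.pLin DiracLinear.qLin (Real.pi / 2) lam ↔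
      ∃ k : ℤ, lam = (DiracLinear.axisEigenvalue (2 * k + 1) : ℂ)) ∧
    StrictMono (fun k : ℤ => DiracLinear.axisEigenvalue (2 * k + 1)) ∧
    (∀ k : ℤ, DiracLinear.IsEigenfunction DiracLinear.pLin DiracLinear.qLin (Real.pi / 2)
        (DiracLinear.axisEigenvalue (2 * k + 1) : ℂ) (DiracLinear.vecU (2 * k + 1)) ∧
      ∀ y : ℝ → Fin 2 → ℂ,
        DiracLinear.IsEigenfunction DiracLinear.pLin DiracLinear.qLin (Real.pi / 2)
            (DiracLinear.axisEigenvalue (2 * k + 1) : ℂ) y ↔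
          ∃ c : ℂ, c ≠ 0 ∧ ∀ x : ℝ, 0 < x → y x = c • DiracLinear.vecU (2 * k + 1) x) := by
  refine ⟨?_, DiracLinear.halfAxisEigenvalue_eq, ?_,
    fun n => DiracLinear.hermitePhi_even_zero_ne_zero n.natAbs,
    fun n => ⟨?_, ?_, DiracLinear.isEigenfunction_even_iff_vecV n⟩,
    DiracLinear.isCauchySolution_iff, DiracLinear.integrableOn_norm_sq_vecV,
    DiracLinear.normingConstant_zero, fun n hn => ?_, DiracLinear.isEigenvalue_pi_div_two_iff,
    fun a b hab => DiracLinear.strictMono_axisEigenvalue (by omega),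
    fun k => ⟨?_, DiracLinear.isEigenfunction_iff (DiracLinear.boundaryCondition_odd k)⟩⟩
  · simpa only [DiracLinear.halfAxisEigenvalue_eq] using DiracLinear.isEigenvalue_zero_iff
  · intro a b hab
    rw [DiracLinear.halfAxisEigenvalue_eq, DiracLinear.halfAxisEigenvalue_eq]
    exact DiracLinear.strictMono_axisEigenvalue (by omega)
  · exact (DiracLinear.isEigenfunction_even_iff n _).2 ⟨1, one_ne_zero, by simp⟩
  · exact (DiracLinear.isEigenfunction_even_iff_vecV n _).2 ⟨1, one_ne_zero, by simp⟩
  · have hn0 : (n : ℤ) ≠ 0 := by omega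
    rw [DiracLinear.normingConstant_of_ne_zero (neg_ne_zero.2 hn0),
      DiracLinear.normingConstant_of_ne_zero hn0, Int.natAbs_neg, Int.natAbs_natCast, sq_abs]
    exact ⟨rfl, rfl, DiracLinear.one_div_hermitePhi_even_zero_sq n⟩
  · exact (DiracLinear.isEigenfunction_iff (DiracLinear.boundaryCondition_odd k) _).2
      ⟨1, one_ne_zero, by simp⟩
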